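/- All graphs are finite, simple and undirected. A path in an edge-colored (respectively vertex-colored) graph is conflict-free if some color is used on exactly one of its edges (respectively vertices). For a connected graph $G$, let $cfc(G)$ (respectively $vcfc(G)$) be the smallest number of colors in a (not necessarily proper) coloring of the edges (respectively vertices) of $G$ such that any two distinct vertices of $G$ are connected by a conflict-free path. Let $C(G)$ be the subgraph of $G$ whose edges are the cut-edges of $G$ and whose vertices are the ends of these edges, and let $h(G)=\max\{cfc(T) : T \text{ is a component of } C(G)\}$, with $h(G)=0$ if $G$ has no cut-edge. Theorem. Let $G$ be a connected graph of diameter $4$. Then $vcfc(G)\le 3$. Moreover, $cfc(G)=2$ if $h(G)\le 1$, and $cfc(G)=h(G)$ if $h(G)\ge 3$. -/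

import Mathlib

namespace SimpleGraph

variable {V : Type*}

/-- Under the edge-coloring `c`, some color is used on exactly one edge of the walk `p`. -/
def EdgeConflictFree {G : SimpleGraph V} {K : Type*} (c : G.edgeSet → K) {u v : V}
    (p : G.Walk u v) : Prop :=
  ∃ i : K, ∃! e : G.edgeSet, (e : Sym2 V) ∈ p.edges ∧ c e = i

/-- Under the vertex-coloring `c`, some color is used on exactly one vertex of the walk `p`. -/
def VertexConflictFree {G : SimpleGraph V} {K : Type*} (c : V → K) {u v : V}
    (p : G.Walk u v) : Prop :=
  ∃ i : K, ∃! w : V, w ∈ p.support ∧ c w = i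

/-- `c` is a conflict-free connection coloring of `G`: any two distinct vertices are joined by a
conflict-free path. -/
def IsConflictFreeConnection (G : SimpleGraph V) {K : Type*} (c : G.edgeSet → K) : Prop :=
  ∀ u v : V, u ≠ v → ∃ p : G.Walk u v, p.IsPath ∧ EdgeConflictFree c p

/-- `c` is a conflict-free vertex-connection coloring of `G`: any two distinct vertices are joined
by a conflict-free path. -/
def IsConflictFreeVertexConnection (G : SimpleGraph V) {K : Type*} (c : V → K) : Prop :=
  ∀ u v : V, u ≠ v → ∃ p : G.Walk u v, p.IsPath ∧ VertexConflictFree c p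

/-- The conflict-free connection number `cfc(G)`: the least number of colors in a conflict-free
connection coloring (and `⊤` if no finite number of colors suffices). -/
noncomputable def cfcNumber (G : SimpleGraph V) : ℕ∞ :=
  ⨅ k ∈ {k : ℕ | ∃ c : G.edgeSet → Fin k, G.IsConflictFreeConnection c}, (k : ℕ∞)

/-- The conflict-free vertex-connection number `vcfc(G)`: the least number of colors in a
conflict-free vertex-connection coloring (and `⊤` if no finite number of colors suffices). -/
noncomputable def vcfcNumber (G : SimpleGraph V) : ℕ∞ :=
  ⨅ k ∈ {k : ℕ | ∃ c : V → Fin k, G.IsConflictFreeVertexConnection c}, (k : ℕ∞)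

/-- The set of cut-edges of `G`. -/
def cutEdges (G : SimpleGraph V) : Set (Sym2 V) :=
  {e | e ∈ G.edgeSet ∧ G.IsBridge e}

/-- The subgraph `C(G)` induced by the set of cut-edges: its edges are the cut-edges of `G`, and its
vertices are the ends of the cut-edges. -/
def cutEdgeSubgraph (G : SimpleGraph V) : G.Subgraph where
  verts := {v | ∃ e ∈ G.cutEdges, v ∈ e}
  Adj u v := s(u, v) ∈ G.cutEdges
  adj_sub h := h.1
  edge_vert h := ⟨_, h, Sym2.mem_mk_left _ _⟩
  symm := ⟨fun u v h => by rwa [Sym2.eq_swap]⟩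

/-- The parameter `h(G)`: the maximum of `cfc(T)` over the components `T` of `C(G)`; it is `0` if
`G` has no cut-edge. -/
noncomputable def cutEdgeCfc (G : SimpleGraph V) : ℕ∞ :=
  ⨆ T : G.cutEdgeSubgraph.coe.ConnectedComponent, T.toSimpleGraph.cfcNumber

end SimpleGraph

/-! Vertices. Some vertex c has at most one separating vertex strictly between it and any other
vertex (`exists_separator_center`): separators are interior to every path, so a diameter of 4 allows
at most three per pair, and a middle one serves as c. Color c with 2, the vertices separating c from
something with 1, the rest with 0. By a two-path case of Menger's theorem, u and v are joined by a
path through c, or some w separates c from both; in that case a path runs through w, and a second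
vertex of color 1 on it would put two separators between c and one vertex.

Edges. Paths made of bridges are unique, so coloring G also colors each component of C(G); this
gives h(G) ≤ cfc(G). Conversely, color the cut-edges optimally and handle pairs not joined by
cut-edges with switching sets S: one path avoids S, another uses one edge of S. If at most one
cut-edge between u and v has the color of S, one of these paths is conflict-free. One set suffices
when h(G) ≤ 1. When h(G) ≥ 3, two disjoint sets are used (`exists_disjoint_isSwitching`): at most
three cut-edges lie between u and v, so two colors cannot both occur twice among them. -/

namespace SimpleGraph

variable {V : Type*} {G : SimpleGraph V}

/-! ### Walks, fans and a two-path Menger theorem -/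

namespace Walk

/-- A walk reaching a set `C` has an initial part meeting `C` only at its last vertex. -/
theorem exists_first_mem {u w : V} (p : G.Walk u w) {C : Set V} (hw : w ∈ C) :
    ∃ y ∈ C, ∃ q : G.Walk u y, q.support ⊆ p.support ∧ ∀ z ∈ q.support, z ∈ C → z = y := by
  induction p with
  | nil => exact ⟨_, hw, nil, by simp, by simp⟩
  | @cons a b c h p ih =>
    by_cases ha : a ∈ C
    · exact ⟨a, ha, nil, by simp, by simp⟩
    · obtain ⟨y, hy, q, hq, hz⟩ := ih hw
      refine ⟨y, hy, cons h q, ?_, ?_⟩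
      · intro z hz'
        simp only [support_cons, List.mem_cons] at hz' ⊢
        exact hz'.imp id (fun h => hq h)
      · intro z hz' hzC
        simp only [support_cons, List.mem_cons] at hz'
        rcases hz' with rfl | hz'
        · exact absurd hzC ha
        · exact hz z hz' hzC

/-- Two walks meeting only at their common end contain a path through that end. -/
theorem exists_isPath_of_support_inter {u w v : V} (p : G.Walk u w) (q : G.Walk w v)
    (h : ∀ z ∈ p.support, z ∈ q.support → z = w) :
    ∃ r : G.Walk u v, r.IsPath ∧ w ∈ r.support := by
  classical
  refine ⟨p.bypass.append q.bypass, ?_, ?_⟩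
  · rw [isPath_def, support_append, List.nodup_append]
    have hq := q.bypass_isPath.support_nodup
    refine ⟨p.bypass_isPath.support_nodup, hq.tail, ?_⟩
    rintro a ha b hb rfl
    have h1 := h a (p.support_bypass_subset_support ha)
      (q.support_bypass_subset_support (List.mem_of_mem_tail hb))
    subst h1
    rw [← cons_tail_support] at hq
    exact (List.nodup_cons.1 hq).1 hb
  · rw [mem_support_append_iff]; exact Or.inl (end_mem_support _)

theorem IsPath.exists_walk_avoiding {u v w z : V} {r : G.Walk u v} (hr : r.IsPath)
    (hw : w ∈ r.support) (hz : z ∈ r.support) (hzw : z ≠ w) :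
    (∃ s : G.Walk z u, w ∉ s.support) ∨ ∃ s : G.Walk z v, w ∉ s.support := by
  classical
  rw [← r.take_spec hw, mem_support_append_iff] at hz
  rcases hz with hz | hz
  · left
    refine ⟨((r.takeUntil w hw).takeUntil z hz).reverse, ?_⟩
    simpa using endpoint_notMem_support_takeUntil (hr.takeUntil hw) hz hzw.symm
  · right
    have hd := hr.dropUntil hw
    refine ⟨(r.dropUntil w hw).dropUntil z hz, fun h => ?_⟩
    rw [← (r.dropUntil w hw).take_spec hz] at hd
    exact hd.ne_of_mem_support_of_append hzw.symm (start_mem_support _) h rfl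

end Walk

/-- Every walk from `u` to `v` passes through `w`. -/
def Separates (G : SimpleGraph V) (w u v : V) : Prop :=
  ∀ p : G.Walk u v, w ∈ p.support

theorem Separates.symm {w u v : V} (h : G.Separates w u v) : G.Separates w v u := fun p => by
  simpa using h p.reverse

theorem Separates.mem_walk {w u v y : V} (h : G.Separates w u v) (p : G.Walk u y)
    (q : G.Walk y v) (hq : w ∉ q.support) : w ∈ p.support := by
  have := h (p.append q)
  rw [Walk.mem_support_append_iff] at this
  exact this.resolve_right hq

/-- There are walks from `w` to `u` and to `v` meeting only at `w`. -/
def HasFan (G : SimpleGraph V) (w u v : V) : Prop :=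
  ∃ (p : G.Walk u w) (q : G.Walk w v), ∀ z ∈ p.support, z ∈ q.support → z = w

/-- Fan rerouting. The vertex x must lie on the first branch p, for otherwise the second branch q
extends to x. A walk Q from u avoiding x would then first hit either q or the part of p beyond x,
and either way the pieces recombine into a fan ending at x. -/
theorem HasFan.separates_of_adj {w u x x' : V} (h : G.HasFan w u x') (hx : ¬ G.HasFan w u x)
    (hadj : G.Adj x' x) : G.Separates x u w := by
  classical
  intro Q
  by_contra hQ
  obtain ⟨p₀, q, hpq₀⟩ := h
  set p := p₀.bypass with hp
  have hpp : p.IsPath := p₀.bypass_isPath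
  have hpq : ∀ z ∈ p.support, z ∈ q.support → z = w := fun z hz =>
    hpq₀ z (p₀.support_bypass_subset_support hz)
  have hxq : x ∉ q.support := fun hxq => hx ⟨p, q.takeUntil x hxq, fun z hz hz' =>
    hpq z hz (q.support_takeUntil_subset_support hxq hz')⟩
  by_cases hxp : x ∈ p.support
  swap
  · refine hx ⟨p, q.concat hadj, fun z hz hz' => ?_⟩
    rw [Walk.support_concat, List.mem_append, List.mem_singleton] at hz'
    rcases hz' with hz' | rfl
    · exact hpq z hz hz'
    · exact absurd hz hxp
  set A := p.dropUntil x hxp with hA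
  have hAp : A.IsPath := hpp.dropUntil hxp
  have hAs : ∀ z ∈ A.support, z ∈ p.support := fun z hz => p.support_dropUntil_subset_support hxp hz
  obtain ⟨y, hy, Q₁, hQ₁, hfirst⟩ := Q.exists_first_mem (C := {z | z ∈ A.support ∨ z ∈ q.support})
    (Or.inl A.end_mem_support)
  by_cases hyq : y ∈ q.support
  · refine hx ⟨Q₁.append (q.takeUntil y hyq).reverse, A.reverse, fun z hz hz' => ?_⟩
    rw [Walk.support_reverse, List.mem_reverse] at hz'
    rw [Walk.mem_support_append_iff, Walk.support_reverse, List.mem_reverse] at hz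
    rcases hz with hz | hz
    · obtain rfl := hfirst z hz (Or.inl hz')
      exact hpq z (hAs z hz') hyq
    · exact hpq z (hAs z hz') (q.support_takeUntil_subset_support hyq hz)
  · have hyA : y ∈ A.support := hy.resolve_right hyq
    have hyx : y ≠ x := by
      rintro rfl
      exact hQ (hQ₁ Q₁.end_mem_support)
    refine hx ⟨Q₁.append (A.dropUntil y hyA), q.concat hadj, fun z hz hz' => ?_⟩
    rw [Walk.support_concat, List.mem_append, List.mem_singleton] at hz'
    rw [Walk.mem_support_append_iff] at hz
    rcases hz' with hz' | rfl
    · rcases hz with hz | hz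
      · obtain rfl := hfirst z hz (Or.inr hz')
        exact absurd hz' hyq
      · exact hpq z (hAs z (A.support_dropUntil_subset_support hyA hz)) hz'
    · rcases hz with hz | hz
      · exact absurd (hQ₁ hz) hQ
      · have h1 := hAp
        rw [← A.take_spec hyA] at h1
        exact absurd rfl (h1.ne_of_mem_support_of_append hyx.symm
          (Walk.start_mem_support _) hz)

/-- The case of Menger's theorem for two walks leaving `w`. -/
theorem Connected.hasFan_or_exists_separates (hG : G.Connected) (w u v : V) :
    G.HasFan w u v ∨ ∃ z ≠ w, G.Separates z w u ∧ G.Separates z w v := by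
  classical
  by_cases hv : G.HasFan w u v
  · exact Or.inl hv
  right
  have hw : G.HasFan w u w := ⟨(hG.preconnected u w).some, Walk.nil, by simp⟩
  -- On each walk from w to v, take the first vertex that no fan reaches: its predecessor is
  -- reached, so it separates u from w.
  have key : ∀ p : G.Walk w v, ∃ z ∈ p.support, ¬ G.HasFan w u z ∧ G.Separates z u w ∧
      ∃ r : G.Walk w z, ∀ y ∈ r.support, ¬ G.HasFan w u y → y = z := by
    intro p
    obtain ⟨z, hz, q, hq, hfirst⟩ := p.exists_first_mem (C := {z | ¬ G.HasFan w u z}) hv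
    refine ⟨z, hq q.end_mem_support, hz, ?_, q, hfirst⟩
    have hnil : ¬ q.Nil := fun hn => hz (hn.eq ▸ hw)
    have hadj := q.adj_penultimate hnil
    refine HasFan.separates_of_adj ?_ hz hadj
    by_contra hpen
    exact hadj.ne (hfirst _ (q.getVert_mem_support _) hpen)
  obtain ⟨z, -, hz, hsep, r, hr⟩ := key (hG.preconnected w v).some
  refine ⟨z, fun h => hz (h ▸ hw), hsep.symm, fun p => ?_⟩
  obtain ⟨z', hz', hzX', hsep', r', hr'⟩ := key p
  -- All walks give the same z. If z and z' differed, the one met first on a path from u to w could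
  -- be joined to w by its own walk r or r', which avoids the other one.
  by_cases hzz : z = z'
  · exact hzz ▸ hz'
  exfalso
  have hz'r : z' ∉ r.support := fun h => hzz (hr z' h hzX').symm
  have hzr' : z ∉ r'.support := fun h => hzz (hr' z h hz)
  obtain ⟨P, hP⟩ := hG.exists_isPath u w
  have h1 := hsep P
  have h2 := hsep' P
  rw [← P.take_spec h1, Walk.mem_support_append_iff] at h2
  have hP' := hP
  rw [← P.take_spec h1] at hP'
  rcases h2 with h2 | h2
  · have hzt : z ∉ ((P.takeUntil z h1).takeUntil z' h2).support :=
      Walk.endpoint_notMem_support_takeUntil (hP.takeUntil h1) h2 hzz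
    have := hsep.symm.mem_walk r' (((P.takeUntil z h1).takeUntil z' h2).reverse) (by simpa using hzt)
    exact hzr' this
  · have hzt : z' ∉ (P.takeUntil z h1).support := fun h =>
      hP'.ne_of_mem_support_of_append (fun h => hzz h.symm) h h2 rfl
    have := hsep'.symm.mem_walk r ((P.takeUntil z h1).reverse) (by simpa using hzt)
    exact hz'r this

/-! ### Separators, the center and the vertex coloring -/

/-- The vertices other than `u` and `v` that lie on every walk from `u` to `v`. -/
def separators (G : SimpleGraph V) (u v : V) : Set V :=
  {w | w ≠ u ∧ w ≠ v ∧ G.Separates w u v}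

theorem separators_self (u : V) : G.separators u u = ∅ := by
  ext z
  simp only [Set.mem_empty_iff_false, iff_false]
  intro hz
  have := hz.2.2 Walk.nil
  simp only [Walk.support_nil, List.mem_singleton] at this
  exact hz.1 this

theorem separators_symm (u v : V) : G.separators u v = G.separators v u := by
  ext w
  exact ⟨fun h => ⟨h.2.1, h.1, h.2.2.symm⟩, fun h => ⟨h.2.1, h.1, h.2.2.symm⟩⟩

theorem Connected.mem_separators_trans_right (hG : G.Connected) {c w z v : V}
    (hw : w ∈ G.separators c v) (hz : z ∈ G.separators w v) : z ∈ G.separators c v := by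
  classical
  refine ⟨?_, hz.2.1, fun p => p.support_dropUntil_subset_support (hw.2.2 p) (hz.2.2 _)⟩
  rintro rfl
  obtain ⟨P, hP⟩ := hG.exists_isPath z v
  have h1 := hw.2.2 P
  have h2 := hz.2.2 (P.dropUntil w h1)
  rw [← P.take_spec h1] at hP
  exact hP.ne_of_mem_support_of_append hz.1 (Walk.start_mem_support _) h2 rfl

theorem Connected.mem_separators_trans_left (hG : G.Connected) {c w z v : V}
    (hw : w ∈ G.separators c v) (hz : z ∈ G.separators c w) : z ∈ G.separators c v := by
  rw [separators_symm] at hw hz ⊢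
  exact hG.mem_separators_trans_right hw hz

/-- A walk from u to x avoiding w, followed by any walk from x to v, must meet w in its second part.
-/
theorem mem_separators_or {u v w x : V} (hw : w ∈ G.separators u v) (hx : w ≠ x) :
    w ∈ G.separators u x ∨ w ∈ G.separators x v := by
  by_cases h : G.Separates w u x
  · exact Or.inl ⟨hw.1, hx, h⟩
  · right
    refine ⟨hx, hw.2.1, fun q => ?_⟩
    unfold Separates at h
    push Not at h
    obtain ⟨p, hp⟩ := h
    have := hw.2.2 (p.append q)
    rw [Walk.mem_support_append_iff] at this
    exact this.resolve_left hp

/-- A vertex in both smaller sets would occur on a path from u to v both before and after w. -/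
theorem Connected.ncard_separators_add_le [Finite V] (hG : G.Connected) {u v w : V}
    (hw : w ∈ G.separators u v) :
    (G.separators u w).ncard + (G.separators w v).ncard + 1 ≤ (G.separators u v).ncard := by
  classical
  have hd : Disjoint (G.separators u w) (G.separators w v) := by
    rw [Set.disjoint_left]
    intro z hz hz'
    obtain ⟨P, hP⟩ := hG.exists_isPath u v
    have h1 := hw.2.2 P
    have h2 := hz.2.2 (P.takeUntil w h1)
    have h3 := hz'.2.2 (P.dropUntil w h1)
    rw [← P.take_spec h1] at hP
    exact hP.ne_of_mem_support_of_append hz'.1 h2 h3 rfl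
  rw [← Set.ncard_union_eq hd, ← Set.ncard_insert_of_notMem (a := w)]
  · refine Set.ncard_le_ncard ?_
    rintro z (rfl | hz | hz)
    · exact hw
    · exact hG.mem_separators_trans_left hw hz
    · exact hG.mem_separators_trans_right hw hz
  · rintro (h | h)
    · exact h.2.1 rfl
    · exact h.1 rfl

theorem Connected.ncard_separators_lt_dist [Finite V] (hG : G.Connected) {u v : V} (huv : u ≠ v) :
    (G.separators u v).ncard + 1 ≤ G.dist u v := by
  classical
  obtain ⟨p, hp, hl⟩ := hG.exists_path_of_dist u v
  have hsub : insert u (insert v (G.separators u v)) ⊆ (p.support.toFinset : Set V) := by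
    rintro z (rfl | rfl | hz)
    · simp
    · simp
    · simpa using hz.2.2 p
  have h1 := Set.ncard_le_ncard hsub
  rw [Set.ncard_insert_of_notMem, Set.ncard_insert_of_notMem, Set.ncard_coe_finset,
    List.toFinset_card_of_nodup hp.support_nodup, Walk.length_support, hl] at h1
  · omega
  · exact fun h => h.2.1 rfl
  · rintro (h | h)
    · exact huv h
    · exact h.1 rfl

/-- If some separator splits `separators u v` evenly enough, it is a center. -/
theorem Connected.ncard_separators_center [Finite V] (hG : G.Connected) {u v c : V} {m k : ℕ}
    (hk : ∀ x y, (G.separators x y).ncard ≤ k) (hc : c ∈ G.separators u v)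
    (hu : m ≤ (G.separators u c).ncard) (hv : m ≤ (G.separators c v).ncard) (hkm : k ≤ m + 2)
    (x : V) : (G.separators c x).ncard ≤ 1 := by
  by_cases hcx : c = x
  · subst hcx
    simp [separators_self]
  rcases mem_separators_or hc hcx with h | h
  · have := hG.ncard_separators_add_le h
    have := hk u x
    omega
  · have := hG.ncard_separators_add_le h
    have := hk x v
    rw [separators_symm c x]
    omega

/-- Take a pair with the most separators. With at most one, an end works; with two, either separator
works; with three, the middle one does. -/
theorem Connected.exists_separator_center [Finite V] (hG : G.Connected)
    (hd : ∀ x y, G.dist x y ≤ 4) : ∃ c, ∀ x, (G.separators c x).ncard ≤ 1 := by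
  classical
  have : Nonempty V := hG.nonempty
  obtain ⟨⟨u, v⟩, hmax⟩ := Finite.exists_max (fun q : V × V => (G.separators q.1 q.2).ncard)
  have hk : ∀ x y, (G.separators x y).ncard ≤ (G.separators u v).ncard := fun x y => hmax (x, y)
  by_cases h1 : (G.separators u v).ncard ≤ 1
  · exact ⟨u, fun x => (hk u x).trans h1⟩
  by_cases huv : u = v
  · subst huv
    simp [separators_self] at h1
  have hlt := hG.ncard_separators_lt_dist huv
  have h4 := hd u v
  by_cases h2 : (G.separators u v).ncard ≤ 2
  · obtain ⟨c, hc⟩ : (G.separators u v).Nonempty := by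
      rw [← Set.ncard_pos]; omega
    exact ⟨c, hG.ncard_separators_center (m := 0) hk hc (by omega) (by omega) (by omega)⟩
  -- Now there are three separators and the distance is 4, so the separators are exactly the
  -- interior vertices of the geodesic p.
  obtain ⟨p, hp, hl⟩ := hG.exists_path_of_dist u v
  have hsub : G.separators u v ⊆ {p.getVert 1, p.getVert 2, p.getVert 3} := by
    intro z hz
    obtain ⟨n, hn, hnl⟩ := Walk.mem_support_iff_exists_getVert.1 (hz.2.2 p)
    have h0 : n ≠ 0 := by
      rintro rfl
      exact hz.1 (by simpa using hn.symm)
    have h4 : n ≠ p.length := by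
      rintro rfl
      exact hz.2.1 (by simpa using hn.symm)
    obtain rfl | rfl | rfl : n = 1 ∨ n = 2 ∨ n = 3 := by omega
    all_goals simp [hn]
  have heq : G.separators u v = {p.getVert 1, p.getVert 2, p.getVert 3} := by
    refine Set.eq_of_subset_of_ncard_le hsub ?_
    have := Set.ncard_insert_le (p.getVert 1) {p.getVert 2, p.getVert 3}
    have := Set.ncard_insert_le (p.getVert 2) {p.getVert 3}
    rw [Set.ncard_singleton] at this
    omega
  have hi : ∀ i j, i ≤ 4 → j ≤ 4 → i ≠ j → p.getVert i ≠ p.getVert j := fun i j hi hj hij h =>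
    hij (hp.getVert_injOn (by simp; omega) (by simp; omega) h)
  have hmem : p.getVert 1 ∈ G.separators u v ∧ p.getVert 2 ∈ G.separators u v ∧
      p.getVert 3 ∈ G.separators u v := by
    rw [heq]; simp
  refine ⟨p.getVert 2, hG.ncard_separators_center (m := 1) hk hmem.2.1 ?_ ?_ (by omega)⟩
  · rw [Nat.one_le_iff_ne_zero, ← Nat.pos_iff_ne_zero, Set.ncard_pos]
    refine ⟨p.getVert 1, hmem.1.1, hi _ _ (by omega) (by omega) (by omega), fun q => ?_⟩
    refine hmem.1.2.2.mem_walk q (p.drop 2) fun h => ?_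
    obtain ⟨n, hn, hnl⟩ := Walk.mem_support_iff_exists_getVert.1 h
    rw [Walk.drop_getVert] at hn
    rw [Walk.drop_length] at hnl
    exact hi _ _ (by omega) (by omega) (by omega) hn
  · rw [Nat.one_le_iff_ne_zero, ← Nat.pos_iff_ne_zero, Set.ncard_pos]
    refine ⟨p.getVert 3, hi _ _ (by omega) (by omega) (by omega), hmem.2.2.2.1, fun q => ?_⟩
    have := hmem.2.2.2.2.symm.mem_walk q.reverse (p.take 2).reverse fun h => ?_
    · simpa using this
    rw [Walk.support_reverse, List.mem_reverse] at h
    obtain ⟨n, hn, hnl⟩ := Walk.mem_support_iff_exists_getVert.1 h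
    rw [Walk.take_getVert] at hn
    exact hi _ _ (by omega) (by omega) (by omega) hn

/-- A vertex within reach of every other through at most one separating vertex yields a
conflict-free vertex-connection coloring with three colors. -/
theorem Connected.exists_isConflictFreeVertexConnection [Finite V] (hG : G.Connected) {c : V}
    (hc : ∀ x, (G.separators c x).ncard ≤ 1) :
    ∃ f : V → Fin 3, G.IsConflictFreeVertexConnection f := by
  classical
  have huniq : ∀ x w z, w ∈ G.separators c x → z ∈ G.separators c x → w = z := fun x w z hw hz =>
    ((Set.ncard_le_one_iff (Set.toFinite _)).1 (hc x)) hw hz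
  refine ⟨fun z => if z = c then 2 else if ∃ x, z ∈ G.separators c x then 1 else 0, ?_⟩
  intro u v huv
  rcases hG.hasFan_or_exists_separates c u v with ⟨p, q, hpq⟩ | ⟨w, hwc, hwu, hwv⟩
  · obtain ⟨r, hr, hcr⟩ := p.exists_isPath_of_support_inter q hpq
    refine ⟨r, hr, 2, c, ⟨hcr, by simp⟩, fun y hy => ?_⟩
    by_contra hyc
    have := hy.2
    simp only [hyc, if_false] at this
    split_ifs at this <;> simp at this
  -- Here w may be u or v, but not both, so it properly separates c from the other one.
  have hw1 : ∃ x, w ∈ G.separators c x := by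
    by_cases h : w = u
    · exact ⟨v, hwc, fun h' => huv (h.symm.trans h'), hwv⟩
    · exact ⟨u, hwc, h, hwu⟩
  rcases hG.hasFan_or_exists_separates w u v with ⟨p, q, hpq⟩ | ⟨z, hzw, hzu, hzv⟩
  · obtain ⟨r, hr, hwr⟩ := p.exists_isPath_of_support_inter q hpq
    refine ⟨r, hr, 1, w, ⟨hwr, by simp [hwc, hw1]⟩, fun y hy => ?_⟩
    by_contra hyw
    have hyc : y ≠ c := by
      rintro rfl
      simpa using hy.2
    have hy1 : ∃ x, y ∈ G.separators c x := by
      by_contra h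
      have := hy.2
      simp only [hyc, h, if_false] at this
      simp at this
    obtain ⟨x, hx⟩ := hy1
    -- From y the path reaches u or v without meeting w, so w also separates c from y.
    have hwy : w ∈ G.separators c y := by
      refine ⟨hwc, Ne.symm hyw, ?_⟩
      rcases hr.exists_walk_avoiding hwr hy.1 hyw with ⟨s, hs⟩ | ⟨s, hs⟩
      · exact fun t => hwu.mem_walk t s hs
      · exact fun t => hwv.mem_walk t s hs
    exact hyw (huniq x _ _ hx (hG.mem_separators_trans_left hx hwy))
  · exfalso
    have hne : ∀ x, G.Separates z w x → w ≠ x := by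
      rintro x h rfl
      exact hzw (by simpa using h Walk.nil)
    have main : ∀ x, G.Separates w c x → G.Separates z w x → z ≠ x → False := by
      intro x h1 h2 h3
      have hw : w ∈ G.separators c x := ⟨hwc, hne x h2, h1⟩
      exact hzw (huniq x _ _ (hG.mem_separators_trans_right hw ⟨hzw, h3, h2⟩) hw)
    by_cases h : z = u
    · exact main v hwv hzv (fun h' => huv (h.symm.trans h'))
    · exact main u hwu hzu h

theorem Connected.vcfcNumber_le_three [Finite V] (hG : G.Connected)
    (hd : ∀ x y, G.dist x y ≤ 4) : G.vcfcNumber ≤ 3 := by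
  obtain ⟨c, hc⟩ := hG.exists_separator_center hd
  exact iInf₂_le 3 (hG.exists_isConflictFreeVertexConnection hc)

/-! ### Spanning trees and switching sets -/

theorem Reachable.of_forall_adj {H H' : SimpleGraph V}
    (h : ∀ a b, H.Adj a b → H'.Reachable a b) {u v : V} (huv : H.Reachable u v) :
    H'.Reachable u v := by
  obtain ⟨p⟩ := huv
  induction p with
  | nil => rfl
  | cons hadj _ ih => exact (h _ _ hadj).trans ih

theorem Preconnected.reachable_deleteEdges_or {H : SimpleGraph V} (hH : H.Preconnected) (a b y : V) :
    (H.deleteEdges {s(a, b)}).Reachable y a ∨ (H.deleteEdges {s(a, b)}).Reachable y b := by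
  -- The endpoint becomes a free variable for the induction, while the deleted edge still mentions
  -- a.
  obtain ⟨c, hc⟩ : ∃ c, c = a := ⟨a, rfl⟩
  obtain ⟨p⟩ := hH y c
  induction p with
  | nil => exact Or.inl (hc ▸ Reachable.refl _)
  | @cons y z _ hadj p ih =>
    replace ih := ih hc
    by_cases h : s(y, z) = s(a, b)
    · rcases Sym2.eq_iff.1 h with ⟨rfl, rfl⟩ | ⟨rfl, rfl⟩
      · exact Or.inl (Reachable.refl _)
      · exact Or.inr (Reachable.refl _)
    · have hr : (H.deleteEdges {s(a, b)}).Reachable y z :=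
        Adj.reachable (by simpa [deleteEdges_adj] using ⟨hadj, by simpa using h⟩)
      exact ih.imp hr.trans hr.trans

theorem IsAcyclic.not_reachable_deleteEdges {T : SimpleGraph V} (hT : T.IsAcyclic) {u v : V}
    {P : T.Walk u v} (hP : P.IsPath) {a b : V} (h : s(a, b) ∈ P.edges) :
    ¬ (T.deleteEdges {s(a, b)}).Reachable u v := by
  classical
  rw [reachable_deleteEdges_iff_exists_walk]
  rintro ⟨p, hp⟩
  have : p.toPath = ⟨P, hP⟩ := (hT.subsingleton_path u v).elim _ _
  have h' : (p.toPath : T.Walk u v) = P := by rw [this]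
  exact hp (p.edges_bypass_subset_edges (by rw [← h'] at h; exact h))

/-- If the tree path between two vertices has an edge which is no bridge of the supergraph `F`,
then they are joined by a path with exactly one edge outside the tree. -/
theorem IsTree.exists_isPath_one_edge_notMem {T F : SimpleGraph V} (hT : T.IsTree) (hTF : T ≤ F)
    {u v : V} {P : T.Walk u v} (hP : P.IsPath) {f : Sym2 V} (hf : f ∈ P.edges)
    (hfF : ¬ F.IsBridge f) :
    ∃ p : F.Walk u v, p.IsPath ∧ ∃ e ∈ p.edges, e ∉ T.edgeSet ∧
      ∀ e' ∈ p.edges, e' ∉ T.edgeSet → e' = e := by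
  classical
  induction f with | h a b =>
  have huv := hT.isAcyclic.not_reachable_deleteEdges hP hf
  obtain ⟨w⟩ := ((hT.connected.mono hTF).connected_delete_edge_of_not_isBridge hfF).preconnected u v
  -- Removing the tree edge f separates u from v in T. Since F without f is connected, some edge d
  -- of F crosses between the two sides; it replaces f.
  obtain ⟨d, -, hd1, hd2⟩ := w.exists_boundary_dart
    {x | (T.deleteEdges {s(a, b)}).Reachable u x} (Reachable.refl _) huv
  have hsplit := hT.connected.preconnected.reachable_deleteEdges_or a b
  have hdv : (T.deleteEdges {s(a, b)}).Reachable d.snd v := by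
    rcases hsplit u with hu | hu <;> rcases hsplit v with hv | hv <;>
      rcases hsplit d.snd with hd | hd
    · exact hd.trans hv.symm
    · exact absurd (hu.trans hv.symm) huv
    · exact absurd (hu.trans hd.symm) hd2
    · exact hd.trans hv.symm
    · exact hd.trans hv.symm
    · exact absurd (hu.trans hd.symm) hd2
    · exact absurd (hu.trans hv.symm) huv
    · exact hd.trans hv.symm
  have hdT : ¬ T.Adj d.fst d.snd := by
    intro h
    refine hd2 (Reachable.trans hd1 (Adj.reachable ?_))
    have := d.adj
    rw [deleteEdges_adj] at this ⊢
    exact ⟨h, this.2⟩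
  have hdF : F.Adj d.fst d.snd := deleteEdges_le _ d.adj
  obtain ⟨p₁, hp₁⟩ := Reachable.exists_isPath hd1
  obtain ⟨p₂, hp₂⟩ := Reachable.exists_isPath hdv
  have hle : T.deleteEdges {s(a, b)} ≤ F := (deleteEdges_le _).trans hTF
  have hpT : ∀ {x y} (p : (T.deleteEdges {s(a, b)}).Walk x y), ∀ e ∈ p.edges, e ∈ T.edgeSet :=
    fun p e he => edgeSet_mono (deleteEdges_le _) (p.edges_subset_edgeSet he)
  refine ⟨(p₁.mapLe hle).append (Walk.cons hdF (p₂.mapLe hle)), ?_, s(d.fst, d.snd), ?_, hdT, ?_⟩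
  · rw [Walk.isPath_def, Walk.support_append, Walk.support_cons, List.tail_cons,
      Walk.support_mapLe_eq_support, Walk.support_mapLe_eq_support, List.nodup_append]
    refine ⟨hp₁.support_nodup, hp₂.support_nodup, ?_⟩
    rintro x hx _ hy rfl
    exact hd2 (Reachable.trans ⟨p₁.takeUntil x hx⟩ (Reachable.symm ⟨p₂.takeUntil x hy⟩))
  · simp
  · intro e he heT
    rw [Walk.edges_append, Walk.edges_cons, Walk.edges_mapLe_eq_edges, Walk.edges_mapLe_eq_edges,
      List.mem_append, List.mem_cons] at he
    rcases he with he | rfl | he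
    · exact absurd (hpT _ _ he) heT
    · rfl
    · exact absurd (hpT _ _ he) heT

/-- `u` and `v` are joined by a walk consisting of cut-edges. -/
def CutReachable (G : SimpleGraph V) (u v : V) : Prop :=
  ∃ p : G.Walk u v, ∀ e ∈ p.edges, e ∈ G.cutEdges

/-- Two vertices not joined by cut-edges alone are joined by a path avoiding the set `S` of
non-cut-edges, and by a path with exactly one edge in `S`. -/
def IsSwitching (G : SimpleGraph V) (S : Set (Sym2 V)) : Prop :=
  (∀ e ∈ S, e ∉ G.cutEdges) ∧ ∀ u v, ¬ G.CutReachable u v →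
    (∃ p : G.Walk u v, p.IsPath ∧ ∀ e ∈ p.edges, e ∉ S) ∧
      ∃ p : G.Walk u v, p.IsPath ∧ ∃ e ∈ p.edges, e ∈ S ∧ ∀ e' ∈ p.edges, e' ∈ S → e' = e

/-- The tree path avoids the set. If it has an edge that is not a cut-edge of G, that edge is not a
bridge of F either, and exchanging it gives a path with one non-tree edge. -/
theorem IsTree.isSwitching {T F : SimpleGraph V} (hT : T.IsTree) (hTF : T ≤ F) (hFG : F ≤ G)
    (h : ∀ f ∈ T.edgeSet, F.IsBridge f → G.IsBridge f) :
    G.IsSwitching (F.edgeSet \ T.edgeSet) := by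
  refine ⟨fun e he hc => ?_, fun u v huv => ?_⟩
  · induction e with | h a b =>
    refine (isBridge_iff.1 hc.2) ((hT.connected.preconnected a b).mono fun x y hxy => ?_)
    rw [deleteEdges_adj]
    refine ⟨hFG (hTF hxy), fun h' => he.2 ?_⟩
    rw [← Set.mem_singleton_iff.1 h']
    exact hxy
  · obtain ⟨P, hP⟩ := hT.connected.exists_isPath u v
    refine ⟨⟨P.mapLe (hTF.trans hFG), hP.mapLe _, fun e he => ?_⟩, ?_⟩
    · rw [Walk.edges_mapLe_eq_edges] at he
      exact fun h' => h'.2 (P.edges_subset_edgeSet he)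
    · obtain ⟨f, hf, hfG⟩ : ∃ f ∈ P.edges, f ∉ G.cutEdges := by
        by_contra! hall
        exact huv ⟨P.mapLe (hTF.trans hFG), by simpa using hall⟩
      have hfT := P.edges_subset_edgeSet hf
      have hfF : ¬ F.IsBridge f := fun hb =>
        hfG ⟨edgeSet_mono (hTF.trans hFG) hfT, h f hfT hb⟩
      obtain ⟨p, hp, e, he, heT, huniq⟩ := hT.exists_isPath_one_edge_notMem hTF hP hf hfF
      refine ⟨p.mapLe hFG, hp.mapLe _, e, by simpa using he, ⟨p.edges_subset_edgeSet he, heT⟩, ?_⟩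
      intro e' he' heS
      rw [Walk.edges_mapLe_eq_edges] at he'
      exact huniq e' he' heS.2

/-- Any use of the edge xy can be rerouted along q, which avoids f. -/
theorem IsBridge.of_deleteEdges {T F : SimpleGraph V} {x y : V} {f : Sym2 V}
    (hf : (F.deleteEdges {s(x, y)}).IsBridge f) (hT : T ≤ F.deleteEdges {s(x, y)})
    (q : T.Walk x y) (hq : f ∉ q.edges) : F.IsBridge f := by
  induction f with | h a b =>
  rw [isBridge_iff] at hf ⊢
  refine fun hr => hf (Reachable.of_forall_adj (fun c d hcd => ?_) hr)
  have hxy : ((F.deleteEdges {s(x, y)}).deleteEdges {s(a, b)}).Reachable x y :=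
    (reachable_deleteEdges_iff_exists_walk.2 ⟨q, hq⟩).mono (deleteEdges_mono hT)
  by_cases h : s(c, d) = s(x, y)
  · rcases Sym2.eq_iff.1 h with ⟨rfl, rfl⟩ | ⟨rfl, rfl⟩
    · exact hxy
    · exact hxy.symm
  · refine Adj.reachable ?_
    rw [deleteEdges_adj] at hcd
    rw [deleteEdges_adj, deleteEdges_adj]
    exact ⟨⟨hcd.1, h⟩, hcd.2⟩

/-- A connected graph has two disjoint switching sets. -/
theorem Connected.exists_disjoint_isSwitching [Finite V] (hG : G.Connected) :
    ∃ S₁ S₂ : Set (Sym2 V), Disjoint S₁ S₂ ∧ G.IsSwitching S₁ ∧ G.IsSwitching S₂ := by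
  classical
  obtain ⟨T, hTG, hT⟩ := hG.exists_isTree_le
  obtain ⟨F, ⟨hTF, hFG, hF⟩, hmin⟩ := exists_minimal_of_wellFoundedLT
    (fun F : SimpleGraph V => T ≤ F ∧ F ≤ G ∧ ∀ f ∈ T.edgeSet, F.IsBridge f → G.IsBridge f)
    ⟨G, hTG, le_rfl, fun _ _ h => h⟩
  have hdel : ∀ e ∉ T.edgeSet, T ≤ F.deleteEdges {e} := by
    intro e he x y hxy
    rw [deleteEdges_adj]
    refine ⟨hTF hxy, fun h => he ?_⟩
    rw [← Set.mem_singleton_iff.1 h]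
    exact hxy
  -- By minimality each non-tree edge e of F is needed: deleting it turns some tree edge `f e`, not
  -- a bridge of G, into a bridge.
  have hpriv : ∀ e : ↥(F.edgeSet \ T.edgeSet), ∃ f ∈ T.edgeSet,
      (F.deleteEdges {e.1}).IsBridge f ∧ ¬ G.IsBridge f := by
    rintro ⟨e, heF, heT⟩
    by_contra! hcon
    have := edgeSet_mono (hmin (y := F.deleteEdges {e})
      ⟨hdel e heT, (deleteEdges_le _).trans hFG, fun f hf hb => hcon f hf hb⟩ (deleteEdges_le _)) heF
    simp at this
  choose f hfT hfb hfG using hpriv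
  have hfF : ∀ e, ¬ F.IsBridge (f e) := fun e hb => hfG e (hF _ (hfT e) hb)
  -- Among the edges `f e'`, the fundamental cycle of e contains exactly `f e`: missing it would
  -- leave `f e` a bridge of F, and containing another `f e'` would put that bridge of F minus e' on
  -- a cycle.
  have hcyc : ∀ e : ↥(F.edgeSet \ T.edgeSet), ∃ (x y : V) (q : T.Walk x y), q.IsPath ∧
      e.1 = s(x, y) ∧ f e ∈ q.edges ∧ ∀ e', e' ≠ e → f e' ∉ q.edges := by
    rintro ⟨e, heF, heT⟩
    induction e with | h x y =>
    obtain ⟨q, hq⟩ := hT.connected.exists_isPath x y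
    refine ⟨x, y, q, hq, rfl, ?_, ?_⟩
    · by_contra hcon
      exact hfF _ ((hfb ⟨s(x, y), heF, heT⟩).of_deleteEdges (hdel _ heT) q hcon)
    · rintro ⟨e', he'F, he'T⟩ hne hmem
      have hadj : (F.deleteEdges {e'}).Adj y x := by
        rw [deleteEdges_adj]
        refine ⟨Adj.symm heF, fun h => hne ?_⟩
        exact Subtype.ext ((Set.mem_singleton_iff.1 h).symm.trans Sym2.eq_swap)
      have hcycle : (Walk.cons hadj (q.mapLe (hdel e' he'T))).IsCycle := by
        refine Path.cons_isCycle ⟨_, hq.mapLe _⟩ hadj fun h => heT ?_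
        rw [Walk.edges_mapLe_eq_edges, Sym2.eq_swap] at h
        exact q.edges_subset_edgeSet h
      exact (hfb ⟨e', he'F, he'T⟩).notMem_edges_of_isCycle hcycle (by simp [hmem])
  have hinj : Function.Injective f := by
    intro e e' h
    by_contra hne
    obtain ⟨x, y, q, -, -, hmem, hnot⟩ := hcyc e
    exact hnot e' (Ne.symm hne) (h ▸ hmem)
  -- Exchanging every `f e` for its e gives a second spanning tree, which contains all of F outside
  -- T. Hence the two complements in F are disjoint.
  set T' := F.deleteEdges (Set.range f) with hT'
  have hrange : Set.range f ⊆ T.edgeSet := by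
    rintro _ ⟨e, rfl⟩
    exact hfT e
  have hT'c : T'.Connected := by
    have : Nonempty V := hG.nonempty
    refine ⟨fun u v => Reachable.of_forall_adj (fun a b hab => ?_) (hT.connected.preconnected u v)⟩
    by_cases hs : s(a, b) ∈ Set.range f
    swap
    · refine Adj.reachable ?_
      rw [hT', deleteEdges_adj]
      exact ⟨hTF hab, hs⟩
    obtain ⟨e, he⟩ := hs
    obtain ⟨x, y, q, hq, hexy, hmem, hnot⟩ := hcyc e
    by_contra hcon
    -- If a and b were disconnected in T', restoring ab would make it a bridge, yet the fundamental
    -- cycle of e survives and passes through ab.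
    have hb : (T' ⊔ edge a b).IsBridge s(a, b) := isBridge_sup_edge.2 (IsBridge.of_not_reachable hcon)
    have hqe : ∀ e'' ∈ q.edges, e'' ∈ (T' ⊔ edge a b).edgeSet := by
      intro e'' he''
      by_cases h : e'' = s(a, b)
      · rw [h]
        exact Or.inr (by simp [edge_adj, hab.ne])
      · rw [edgeSet_sup, hT', edgeSet_deleteEdges]
        refine Or.inl ⟨edgeSet_mono hTF (q.edges_subset_edgeSet he''), ?_⟩
        rintro ⟨e', rfl⟩
        by_cases hee : e' = e
        · exact h (hee ▸ he)
        · exact hnot e' hee he''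
    have heT : s(y, x) ∉ T.edgeSet := by
      rw [Sym2.eq_swap, ← hexy]
      exact e.2.2
    have hadj : (T' ⊔ edge a b).Adj y x := by
      refine Or.inl ?_
      rw [hT', deleteEdges_adj]
      exact ⟨Adj.symm (by have := e.2.1; rwa [hexy] at this), fun h => heT (hrange h)⟩
    have hcycle : (Walk.cons hadj (q.transfer _ hqe)).IsCycle := by
      refine Path.cons_isCycle ⟨_, hq.transfer hqe⟩ hadj fun h => heT ?_
      rw [Walk.edges_transfer] at h
      exact q.edges_subset_edgeSet h
    refine hb.notMem_edges_of_isCycle hcycle ?_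
    rw [Walk.edges_cons, Walk.edges_transfer, ← he]
    exact List.mem_cons_of_mem _ hmem
  have hT't : T'.IsTree := by
    rw [isTree_iff_connected_and_card]
    refine ⟨hT'c, ?_⟩
    rw [← (isTree_iff_connected_and_card.1 hT).2]
    have h1 : (F.edgeSet \ Set.range f).ncard + (Set.range f).ncard = F.edgeSet.ncard :=
      Set.ncard_sdiff_add_ncard_of_subset (hrange.trans (edgeSet_mono hTF))
    have h2 : (F.edgeSet \ T.edgeSet).ncard + T.edgeSet.ncard = F.edgeSet.ncard :=
      Set.ncard_sdiff_add_ncard_of_subset (edgeSet_mono hTF)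
    have h3 : (Set.range f).ncard = (F.edgeSet \ T.edgeSet).ncard := by
      rw [← Set.image_univ, Set.ncard_image_of_injective _ hinj, Set.ncard_univ]
      rfl
    rw [hT', edgeSet_deleteEdges]
    change (F.edgeSet \ Set.range f).ncard + 1 = T.edgeSet.ncard + 1
    omega
  refine ⟨F.edgeSet \ T.edgeSet, F.edgeSet \ T'.edgeSet, ?_, hT.isSwitching hTF hFG hF,
    hT't.isSwitching (deleteEdges_le _) hFG ?_⟩
  · rw [Set.disjoint_left]
    rintro e ⟨heF, heT⟩ ⟨-, heT'⟩
    refine heT' ?_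
    rw [hT', edgeSet_deleteEdges]
    exact ⟨heF, fun h => heT (hrange h)⟩
  · intro e he hb
    by_cases heT : e ∈ T.edgeSet
    · exact hF e heT hb
    · exfalso
      induction e with | h a b =>
      exact isBridge_iff.1 hb ((hT.connected.preconnected a b).mono (hdel _ heT))

/-! ### Cut-edges and the components of C(G) -/

theorem IsBridge.mem_edges_of_isPath {e : Sym2 V} (he : G.IsBridge e) {u v : V} {p : G.Walk u v}
    (hp : p.IsPath) (hep : e ∈ p.edges) (q : G.Walk u v) : e ∈ q.edges := by
  induction p with
  | nil => simp at hep
  | @cons u w v h p ih =>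
    rw [Walk.cons_isPath_iff] at hp
    rw [Walk.edges_cons, List.mem_cons] at hep
    by_cases heq : e = s(u, w)
    · subst heq
      have := isBridge_iff_forall_walk_mem_edges.1 he (q.append p.reverse)
      rw [Walk.edges_append, List.mem_append, Walk.edges_reverse, List.mem_reverse] at this
      exact this.resolve_right fun h' => hp.2 (p.fst_mem_support_of_mem_edges h')
    · have := ih hp.1 (hep.resolve_left heq) (Walk.cons h.symm q)
      rw [Walk.edges_cons, List.mem_cons, Sym2.eq_swap] at this
      exact this.resolve_left heq

/-- The first edge of q is a bridge, so it lies on p, and as p does not revisit u it is also the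
first edge of p; induct on the rest. -/
theorem Walk.IsPath.eq_of_forall_isBridge {u v : V} {p q : G.Walk u v} (hp : p.IsPath)
    (hq : q.IsPath) (hb : ∀ e ∈ q.edges, G.IsBridge e) : p = q := by
  induction q with
  | nil => exact (Walk.isPath_iff_nil.1 hp).eq_nil
  | @cons u w v h q ih =>
    have hmem := (hb s(u, w) (by simp)).mem_edges_of_isPath hq (by simp) p
    rw [Walk.cons_isPath_iff] at hq
    cases p with
    | nil => simp at hmem
    | @cons _ x _ h' p =>
      rw [Walk.cons_isPath_iff] at hp
      rw [Walk.edges_cons, List.mem_cons] at hmem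
      rcases hmem with hmem | hmem
      · obtain rfl : w = x := by
          rcases Sym2.eq_iff.1 hmem with h1 | h1
          · exact h1.2
          · exact absurd h1.1 h'.ne
        rw [ih hp.1 hq.1 fun e he => hb e (by simp [he])]
      · exact absurd (p.fst_mem_support_of_mem_edges hmem) hp.2

theorem edgeConflictFree_of_forall {K : Type*} {c : Sym2 V → K} {u v : V} {p : G.Walk u v}
    {e : Sym2 V} (he : e ∈ p.edges) (h : ∀ e' ∈ p.edges, c e' = c e → e' = e) :
    EdgeConflictFree (fun e : G.edgeSet => c e) p :=
  ⟨c e, ⟨e, p.edges_subset_edgeSet he⟩, ⟨he, rfl⟩, fun e' he' => Subtype.ext (h e' he'.1 he'.2)⟩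

theorem edgeConflictFree_map_iff {W K : Type*} {H : SimpleGraph W} (φ : H →g G)
    (hφ : Function.Injective φ) (c : G.edgeSet → K) {u v : W} (p : H.Walk u v) :
    EdgeConflictFree c (p.map φ) ↔ EdgeConflictFree (fun e => c (φ.mapEdgeSet e)) p := by
  have hinj := Sym2.map.injective hφ
  refine exists_congr fun i => ⟨?_, ?_⟩
  · rintro ⟨e, ⟨he, hc⟩, huniq⟩
    rw [Walk.edges_map, List.mem_map] at he
    obtain ⟨e₀, he₀, hee⟩ := he
    have heq : φ.mapEdgeSet ⟨e₀, p.edges_subset_edgeSet he₀⟩ = e := Subtype.ext hee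
    refine ⟨⟨e₀, p.edges_subset_edgeSet he₀⟩, ⟨he₀, (congrArg c heq).trans hc⟩, fun e' he' => ?_⟩
    have := huniq (φ.mapEdgeSet e')
      ⟨by rw [Walk.edges_map]; exact List.mem_map_of_mem he'.1, he'.2⟩
    exact Subtype.ext (hinj (congrArg Subtype.val (this.trans heq.symm)))
  · rintro ⟨e, ⟨he, hc⟩, huniq⟩
    refine ⟨φ.mapEdgeSet e, ⟨by rw [Walk.edges_map]; exact List.mem_map_of_mem he, hc⟩, ?_⟩
    rintro e' ⟨he', hc'⟩
    rw [Walk.edges_map, List.mem_map] at he'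
    obtain ⟨e₀, he₀, hee⟩ := he'
    have heq : φ.mapEdgeSet ⟨e₀, p.edges_subset_edgeSet he₀⟩ = e' := Subtype.ext hee
    rw [← heq, huniq ⟨e₀, p.edges_subset_edgeSet he₀⟩ ⟨he₀, (congrArg c heq).trans hc'⟩]

theorem exists_isConflictFreeConnection_of_cfcNumber_le {k : ℕ} (h : G.cfcNumber ≤ k) :
    ∃ c : G.edgeSet → Fin k, G.IsConflictFreeConnection c := by
  -- The strict bound extracts an actual number of colors from the infimum; spare colors are then
  -- left unused.
  have hlt : G.cfcNumber < (k + 1 : ℕ) := lt_of_le_of_lt h (by exact_mod_cast Nat.lt_succ_self k)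
  unfold cfcNumber at hlt
  simp only [iInf_lt_iff] at hlt
  obtain ⟨k', ⟨c, hc⟩, hk'⟩ := hlt
  have hle : k' ≤ k := by
    have : k' < k + 1 := by exact_mod_cast hk'
    omega
  refine ⟨fun e => Fin.castLE hle (c e), fun u v huv => ?_⟩
  obtain ⟨p, hp, i, e, ⟨he, rfl⟩, huniq⟩ := hc u v huv
  exact ⟨p, hp, _, e, ⟨he, rfl⟩, fun e' he' => huniq e' ⟨he'.1, Fin.castLE_injective hle he'.2⟩⟩

/-- The inclusion of a component of `C(G)` in `G`. -/
def cutComponentHom (T : G.cutEdgeSubgraph.coe.ConnectedComponent) : T.toSimpleGraph →g G :=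
  G.cutEdgeSubgraph.hom.comp T.toSimpleGraph_hom

theorem cutComponentHom_injective (T : G.cutEdgeSubgraph.coe.ConnectedComponent) :
    Function.Injective (cutComponentHom T) := fun _ _ h => Subtype.ext (Subtype.ext h)

theorem mem_cutEdges_of_mem_edges_map {T : G.cutEdgeSubgraph.coe.ConnectedComponent} {a b : T}
    (q : T.toSimpleGraph.Walk a b) {e : Sym2 V} (he : e ∈ (q.map (cutComponentHom T)).edges) :
    e ∈ G.cutEdges := by
  rw [Walk.edges_map, List.mem_map] at he
  obtain ⟨e₀, he₀, rfl⟩ := he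
  have := q.edges_subset_edgeSet he₀
  induction e₀ with | h x y =>
  exact this

/-- Distinctness matters: a vertex on no cut-edge is joined to itself by the empty walk but lies in
no component. -/
theorem CutReachable.exists_component {u v : V} (h : G.CutReachable u v) (huv : u ≠ v) :
    ∃ (T : G.cutEdgeSubgraph.coe.ConnectedComponent) (a b : T),
      cutComponentHom T a = u ∧ cutComponentHom T b = v := by
  have key : ∀ {u v : V} (p : G.Walk u v), (∀ e ∈ p.edges, e ∈ G.cutEdges) →
      ∀ hu : u ∈ G.cutEdgeSubgraph.verts, ∃ hv : v ∈ G.cutEdgeSubgraph.verts,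
        G.cutEdgeSubgraph.coe.Reachable ⟨u, hu⟩ ⟨v, hv⟩ := by
    intro u v p
    induction p with
    | nil => exact fun _ hu => ⟨hu, Reachable.refl _⟩
    | @cons u w v hadj p ih =>
      intro hp hu
      have hmem : s(u, w) ∈ G.cutEdges := hp _ (by simp)
      have hw : w ∈ G.cutEdgeSubgraph.verts := ⟨_, hmem, Sym2.mem_mk_right _ _⟩
      obtain ⟨hv, hr⟩ := ih (fun e he => hp e (by simp [he])) hw
      have hadj' : G.cutEdgeSubgraph.coe.Adj ⟨u, hu⟩ ⟨w, hw⟩ := hmem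
      exact ⟨hv, hadj'.reachable.trans hr⟩
  obtain ⟨p, hp⟩ := h
  have hu : u ∈ G.cutEdgeSubgraph.verts := by
    cases p with
    | nil => exact absurd rfl huv
    | @cons _ w _ hadj p => exact ⟨s(u, w), hp _ (by simp), Sym2.mem_mk_left _ _⟩
  obtain ⟨hv, hr⟩ := key p hp hu
  exact ⟨G.cutEdgeSubgraph.coe.connectedComponentMk ⟨u, hu⟩, ⟨⟨u, hu⟩, rfl⟩,
    ⟨⟨v, hv⟩, ConnectedComponent.sound hr.symm⟩, rfl, rfl⟩

theorem cutEdgeCfc_le_cfcNumber (G : SimpleGraph V) : G.cutEdgeCfc ≤ G.cfcNumber := by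
  refine iSup_le fun T => le_iInf₂ fun k ⟨c, hc⟩ => iInf₂_le k ?_
  refine ⟨fun e => c ((cutComponentHom T).mapEdgeSet e), fun a b hab => ?_⟩
  obtain ⟨q, hq⟩ := T.connected_toSimpleGraph.exists_isPath a b
  obtain ⟨p, hp, hpc⟩ := hc _ _ ((cutComponentHom_injective T).ne hab)
  refine ⟨q, hq, (edgeConflictFree_map_iff _ (cutComponentHom_injective T) c q).1 ?_⟩
  rwa [hp.eq_of_forall_isBridge (Walk.IsPath.map (cutComponentHom_injective T) hq)
    fun e he => (mem_cutEdges_of_mem_edges_map q he).2] at hpc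

/-- Colorings of the components of `C(G)` combine to one coloring. -/
theorem exists_coloring_cutEdges {k : ℕ} (h : G.cutEdgeCfc ≤ k) (d : Fin k) :
    ∃ c : Sym2 V → Fin k, ∀ u v, u ≠ v → G.CutReachable u v →
      ∃ p : G.Walk u v, p.IsPath ∧ (∀ e ∈ p.edges, e ∈ G.cutEdges) ∧
        ∃ e ∈ p.edges, ∀ e' ∈ p.edges, c e' = c e → e' = e := by
  have hT : ∀ T : G.cutEdgeSubgraph.coe.ConnectedComponent,
      ∃ c : T.toSimpleGraph.edgeSet → Fin k, T.toSimpleGraph.IsConflictFreeConnection c := fun T =>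
    exists_isConflictFreeConnection_of_cfcNumber_le
      ((le_iSup (fun T : G.cutEdgeSubgraph.coe.ConnectedComponent => T.toSimpleGraph.cfcNumber)
        T).trans h)
  choose c hc using hT
  let f : (Σ T : G.cutEdgeSubgraph.coe.ConnectedComponent, T.toSimpleGraph.edgeSet) → Sym2 V :=
    fun x => Sym2.map (cutComponentHom x.1) x.2.1
  -- Edges of different components are different edges of G, so the component colorings glue without
  -- conflict.
  have hf : Function.Injective f := by
    rintro ⟨T, e, he⟩ ⟨T', e', he'⟩ heq
    have hTT : T = T' := by
      induction e with | h a b =>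
      induction e' with | h a' b' =>
      have ha : G.cutEdgeSubgraph.coe.connectedComponentMk a.1 = T := a.2
      have ha' : G.cutEdgeSubgraph.coe.connectedComponentMk a'.1 = T' := a'.2
      have hb' : G.cutEdgeSubgraph.coe.connectedComponentMk b'.1 = T' := b'.2
      rcases Sym2.eq_iff.1 heq with h1 | h1
      · rw [← ha, ← ha', show a.1 = a'.1 from Subtype.ext h1.1]
      · rw [← ha, ← hb', show a.1 = b'.1 from Subtype.ext h1.1]
    subst hTT
    obtain rfl := Sym2.map.injective (cutComponentHom_injective T) heq
    rfl
  refine ⟨Function.extend f (fun x => c x.1 x.2) fun _ => d, fun u v huv hr => ?_⟩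
  obtain ⟨T, a, b, rfl, rfl⟩ := hr.exists_component huv
  obtain ⟨q, hq, i, ⟨e, heT⟩, ⟨he, hi⟩, huniq⟩ := hc T a b fun h => huv (h ▸ rfl)
  refine ⟨q.map (cutComponentHom T), Walk.IsPath.map (cutComponentHom_injective T) hq,
    fun e he => mem_cutEdges_of_mem_edges_map q he, Sym2.map (cutComponentHom T) e, ?_, ?_⟩
  · rw [Walk.edges_map]
    exact List.mem_map_of_mem he
  · intro e' he' hcol
    rw [Walk.edges_map, List.mem_map] at he'
    obtain ⟨e₀, he₀, rfl⟩ := he'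
    have h1 := hf.extend_apply (fun x => c x.1 x.2) (fun _ => d) ⟨T, e, heT⟩
    have h2 := hf.extend_apply (fun x => c x.1 x.2) (fun _ => d)
      ⟨T, e₀, q.edges_subset_edgeSet he₀⟩
    have h3 := (h2.symm.trans (hcol.trans h1)).trans hi
    exact congrArg (Sym2.map (cutComponentHom T)) (congrArg Subtype.val (huniq ⟨e₀, _⟩ ⟨he₀, h3⟩))

/-! ### Bounds for the edge coloring -/

/-- If the non-cut-edges of color `i` form a switching set, and at most one of the cut-edges
between `u` and `v` has color `i`, then `u` and `v` are joined by a conflict-free path. -/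
theorem IsSwitching.exists_conflictFree_path {S : Set (Sym2 V)} (hS : G.IsSwitching S) {K : Type*}
    {c : Sym2 V → K} {i : K} (hc : ∀ e ∈ G.edgeSet, e ∉ G.cutEdges → (c e = i ↔ e ∈ S)) {u v : V}
    (huv : ¬ G.CutReachable u v)
    (hi : {e | e ∈ G.cutEdges ∧ (∀ p : G.Walk u v, e ∈ p.edges) ∧ c e = i}.Subsingleton) :
    ∃ p : G.Walk u v, p.IsPath ∧ EdgeConflictFree (fun e : G.edgeSet => c e) p := by
  obtain ⟨⟨p, hp, hpS⟩, q, hq, e, he, heS, huniq⟩ := hS.2 u v huv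
  by_cases hne : ∃ e₀, e₀ ∈ G.cutEdges ∧ (∀ p : G.Walk u v, e₀ ∈ p.edges) ∧ c e₀ = i
  · obtain ⟨e₀, he₀⟩ := hne
    refine ⟨p, hp, edgeConflictFree_of_forall (he₀.2.1 p) fun e' he' hcol => ?_⟩
    rw [he₀.2.2] at hcol
    by_cases hcut : e' ∈ G.cutEdges
    · exact hi ⟨hcut, hcut.2.mem_edges_of_isPath hp he', hcol⟩ he₀
    · exact absurd ((hc e' (p.edges_subset_edgeSet he') hcut).1 hcol) (hpS e' he')
  · refine ⟨q, hq, edgeConflictFree_of_forall he fun e' he' hcol => ?_⟩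
    rw [(hc e (q.edges_subset_edgeSet he) (hS.1 e heS)).2 heS] at hcol
    by_cases hcut : e' ∈ G.cutEdges
    · exact absurd ⟨e', hcut, hcut.2.mem_edges_of_isPath hq he', hcol⟩ hne
    · exact huniq e' he' ((hc e' (q.edges_subset_edgeSet he') hcut).1 hcol)

theorem Connected.cfcNumber_le_two [Finite V] (hG : G.Connected) (h : G.cutEdgeCfc ≤ 1) :
    G.cfcNumber ≤ 2 := by
  classical
  obtain ⟨S, -, -, hS, -⟩ := hG.exists_disjoint_isSwitching
  obtain ⟨c, hc⟩ := exists_coloring_cutEdges (k := 1) (by exact_mod_cast h) 0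
  refine iInf₂_le 2 ⟨fun e => if e.1 ∈ S then 1 else 0, fun u v huv => ?_⟩
  by_cases hr : G.CutReachable u v
  · obtain ⟨p, hp, -, e, he, huniq⟩ := hc u v huv hr
    -- With a single color, a conflict-free path has only one edge, so it stays conflict-free under
    -- any coloring.
    exact ⟨p, hp, edgeConflictFree_of_forall (c := fun e => if e ∈ S then (1 : Fin 2) else 0) he
      fun e' he' _ => huniq e' he' (Subsingleton.elim _ _)⟩
  · refine hS.exists_conflictFree_path (c := fun e => if e ∈ S then (1 : Fin 2) else 0) (i := 1)
      (fun e _ _ => by by_cases he : e ∈ S <;> simp [he]) hr ?_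
    rintro e ⟨hcut, -, he⟩
    have : e ∉ S := fun h' => hS.1 e h' hcut
    simp [this] at he

/-- A geodesic contains all these cut-edges and at least one edge that is not a cut-edge. -/
theorem Connected.ncard_cutEdges_between_lt [Finite V] (hG : G.Connected) {u v : V}
    (huv : ¬ G.CutReachable u v) :
    {e | e ∈ G.cutEdges ∧ ∀ p : G.Walk u v, e ∈ p.edges}.ncard < G.dist u v := by
  classical
  obtain ⟨p, hp⟩ := hG.exists_walk_length_eq_dist u v
  obtain ⟨f, hf, hfc⟩ : ∃ f ∈ p.edges, f ∉ G.cutEdges := by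
    by_contra! hall
    exact huv ⟨p, hall⟩
  have hsub : insert f {e | e ∈ G.cutEdges ∧ ∀ p : G.Walk u v, e ∈ p.edges} ⊆
      (p.edges.toFinset : Set (Sym2 V)) := by
    rintro e (rfl | he)
    · simpa using hf
    · simpa using he.2 p
  have h1 := Set.ncard_le_ncard hsub
  rw [Set.ncard_insert_of_notMem (fun h => hfc h.1), Set.ncard_coe_finset] at h1
  have h2 := p.edges.toFinset_card_le
  rw [Walk.length_edges, hp] at h2
  omega

theorem Connected.cfcNumber_le_of_three_le [Finite V] (hG : G.Connected)
    (hd : ∀ x y, G.dist x y ≤ 4) {k : ℕ} (hk : 3 ≤ k) (h : G.cutEdgeCfc ≤ k) :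
    G.cfcNumber ≤ k := by
  classical
  obtain ⟨S₁, S₂, hdisj, hS₁, hS₂⟩ := hG.exists_disjoint_isSwitching
  obtain ⟨k, rfl⟩ := Nat.exists_eq_add_of_le' hk
  obtain ⟨c₀, hc₀⟩ := exists_coloring_cutEdges h 0
  obtain ⟨c, hcdef⟩ : ∃ c : Sym2 V → Fin (k + 3), c = fun e =>
    if e ∈ G.cutEdges then c₀ e else if e ∈ S₁ then 1 else if e ∈ S₂ then 2 else 0 := ⟨_, rfl⟩
  have hccut : ∀ e ∈ G.cutEdges, c e = c₀ e := fun e he => by simp [hcdef, he]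
  have h01 : (0 : Fin (k + 3)) ≠ 1 := by simp
  have h02 : (0 : Fin (k + 3)) ≠ 2 := by
    simp [Fin.ext_iff, Nat.mod_eq_of_lt (show 2 < k + 3 by omega)]
  have h12 : (1 : Fin (k + 3)) ≠ 2 := by
    simp [Fin.ext_iff, Nat.mod_eq_of_lt (show 2 < k + 3 by omega)]
  have hc1 : ∀ e ∈ G.edgeSet, e ∉ G.cutEdges → (c e = 1 ↔ e ∈ S₁) := fun e _ he => by
    by_cases h1 : e ∈ S₁ <;> by_cases h2 : e ∈ S₂ <;> simp [hcdef, he, h1, h2, h12.symm, h01]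
  have hc2 : ∀ e ∈ G.edgeSet, e ∉ G.cutEdges → (c e = 2 ↔ e ∈ S₂) := fun e _ he => by
    by_cases h1 : e ∈ S₁
    · have h2 : e ∉ S₂ := Set.disjoint_left.1 hdisj h1
      simp [hcdef, he, h1, h2, h12]
    · by_cases h2 : e ∈ S₂ <;> simp [hcdef, he, h1, h2, h02]
  refine iInf₂_le (k + 3) ⟨fun e => c e, fun u v huv => ?_⟩
  by_cases hr : G.CutReachable u v
  · obtain ⟨p, hp, hcut, e, he, huniq⟩ := hc₀ u v huv hr
    refine ⟨p, hp, edgeConflictFree_of_forall he fun e' he' hcol => huniq e' he' ?_⟩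
    rwa [hccut _ (hcut _ he), hccut _ (hcut _ he')] at hcol
  by_cases h1 : {e | e ∈ G.cutEdges ∧ (∀ p : G.Walk u v, e ∈ p.edges) ∧ c e = 1}.Subsingleton
  · exact hS₁.exists_conflictFree_path hc1 hr h1
  by_cases h2 : {e | e ∈ G.cutEdges ∧ (∀ p : G.Walk u v, e ∈ p.edges) ∧ c e = 2}.Subsingleton
  · exact hS₂.exists_conflictFree_path hc2 hr h2
  -- Otherwise colors 1 and 2 each occur on two cut-edges between u and v, which makes four, but
  -- distance at most 4 allows only three.
  exfalso
  rw [← Set.ncard_le_one_iff_subsingleton] at h1 h2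
  have hlt := hG.ncard_cutEdges_between_lt hr
  have hd4 := hd u v
  have hdis : Disjoint {e | e ∈ G.cutEdges ∧ (∀ p : G.Walk u v, e ∈ p.edges) ∧ c e = 1}
      {e | e ∈ G.cutEdges ∧ (∀ p : G.Walk u v, e ∈ p.edges) ∧ c e = 2} :=
    Set.disjoint_left.2 fun e he he' => h12 (he.2.2.symm.trans he'.2.2)
  have hle := Set.ncard_le_ncard (Set.union_subset
    (show {e | e ∈ G.cutEdges ∧ (∀ p : G.Walk u v, e ∈ p.edges) ∧ c e = 1} ⊆
      {e | e ∈ G.cutEdges ∧ ∀ p : G.Walk u v, e ∈ p.edges} from fun e he => ⟨he.1, he.2.1⟩)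
    (show {e | e ∈ G.cutEdges ∧ (∀ p : G.Walk u v, e ∈ p.edges) ∧ c e = 2} ⊆
      {e | e ∈ G.cutEdges ∧ ∀ p : G.Walk u v, e ∈ p.edges} from fun e he => ⟨he.1, he.2.1⟩))
  rw [Set.ncard_union_eq hdis] at hle
  omega

theorem two_le_cfcNumber {u v : V} (h : 2 ≤ G.dist u v) : 2 ≤ G.cfcNumber := by
  classical
  refine le_iInf₂ fun k ⟨c, hc⟩ => ?_
  by_contra hk
  have hk2 : k < 2 := by
    rw [not_le] at hk
    exact_mod_cast hk
  have huv : u ≠ v := by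
    rintro rfl
    simp at h
  obtain ⟨p, hp, i, e, ⟨he, hi⟩, huniq⟩ := hc u v huv
  have : Subsingleton (Fin k) := by
    interval_cases k <;> infer_instance
  have hsub : p.edges.toFinset ⊆ {e.1} := by
    intro e' he'
    rw [List.mem_toFinset] at he'
    rw [Finset.mem_singleton]
    exact congrArg Subtype.val (huniq ⟨e', p.edges_subset_edgeSet he'⟩ ⟨he', Subsingleton.elim _ _⟩)
  have h1 := Finset.card_le_card hsub
  rw [List.toFinset_card_of_nodup hp.isTrail.edges_nodup, Walk.length_edges,
    Finset.card_singleton] at h1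
  have h2 := G.dist_le p
  omega

end SimpleGraph

theorem mainTheorem6 {V : Type*} [Finite V] (G : SimpleGraph V) (hconn : G.Connected)
    (hdiam : G.diam = 4) :
    G.vcfcNumber ≤ 3 ∧
      (G.cutEdgeCfc ≤ 1 → G.cfcNumber = 2) ∧
      (3 ≤ G.cutEdgeCfc → G.cfcNumber = G.cutEdgeCfc) := by
  have hne : Nonempty V := hconn.nonempty
  -- An infinite `ediam` would give `diam` the value 0.
  have htop : G.ediam ≠ ⊤ := by
    intro h
    simp [SimpleGraph.diam, h] at hdiam
  have hd : ∀ x y, G.dist x y ≤ 4 := fun x y => hdiam ▸ SimpleGraph.dist_le_diam htop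
  refine ⟨hconn.vcfcNumber_le_three hd, fun h => ?_, fun h => ?_⟩
  · obtain ⟨u, v, huv⟩ := G.exists_dist_eq_diam
    exact le_antisymm (hconn.cfcNumber_le_two h)
      (SimpleGraph.two_le_cfcNumber (by omega : 2 ≤ G.dist u v))
  · refine le_antisymm ?_ G.cutEdgeCfc_le_cfcNumber
    rcases eq_or_ne G.cutEdgeCfc ⊤ with htop' | htop'
    · rw [htop']
      exact le_top
    · lift G.cutEdgeCfc to ℕ using htop' with k hk
      exact hconn.cfcNumber_le_of_three_le hd (by exact_mod_cast h) hk.ge
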